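/- Let $N\ge 1$, let $J_1,\dots,J_{N-1}>0$ and $K_1,\dots,K_{N-1},B_1,\dots,B_N$ be real numbers, and consider the chain of $N$ qubits with Hamiltonian $$H=\sum_{n=1}^{N-1}J_n(X_nX_{n+1}+Y_nY_{n+1})+\sum_{n=1}^{N-1}K_nZ_nZ_{n+1}+\sum_{n=1}^{N}B_nZ_n ,$$ where $X_n,Y_n,Z_n$ are the Pauli matrices acting on qubit $n$ ($K_n=0$ is the exchange model and $K_n=J_n$ is the Heisenberg model, both in the magnetic fields $B_n$). Suppose that the chain is capable of perfect end-to-end transfer, i.e. there are a time $t_0>0$ and a phase $\phi\in\mathbb{R}$ with $$e^{-iHt_0}|10\cdots00\rangle=e^{i\phi}|00\cdots01\rangle .$$ Let $h$ be the $N\times N$ matrix of $H$ on the single-excitation subspace, with basis $|n\rangle$ ($n=1,\dots,N$), where $|n\rangle$ has qubit $n$ in state $|1\rangle$ and all other qubits in state $|0\rangle$. Let $|\lambda_1\rangle$ be a normalised eigenvector of $h$ for its largest eigenvalue $\lambda_1$. Then $|\langle\lambda_1|1\rangle|^2$ is rational. If $N\ge 3$, then its denominator in lowest terms is divisible by $2^{\lceil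 (N+1)/2\rceil}$; if $N=2$, then its value is $1/2$. -/

import Mathlib

/-! Nearest-neighbour qubit chains with `M` bonds, hence with `M + 1` sites, numbered
`0, …, M`. The computational basis of the state space is indexed by the configurations
`Fin (M + 1) → Fin 2`. -/

namespace SpinChain

/-- The Pauli matrix `X`. -/
def pauliX : Matrix (Fin 2) (Fin 2) ℂ := !![0, 1; 1, 0]

/-- The Pauli matrix `Y`. -/
def pauliY : Matrix (Fin 2) (Fin 2) ℂ := !![0, -Complex.I; Complex.I, 0]

/-- The Pauli matrix `Z`. -/
def pauliZ : Matrix (Fin 2) (Fin 2) ℂ := !![1, 0; 0, -1]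

/-- Operators on the `2 ^ (M + 1)`-dimensional state space of the chain. -/
abbrev Operator (M : ℕ) : Type :=
  Matrix (Fin (M + 1) → Fin 2) (Fin (M + 1) → Fin 2) ℂ

/-- The one-qubit operator `A` acting on site `n`, tensored with the identity on all other
sites. -/
def onSite {M : ℕ} (n : Fin (M + 1)) (A : Matrix (Fin 2) (Fin 2) ℂ) : Operator M :=
  fun s t => if ∀ m, m ≠ n → s m = t m then A (s n) (t n) else 0

/-- The chain Hamiltonian
`∑ₙ Jₙ (Xₙ Xₙ₊₁ + Yₙ Yₙ₊₁) + ∑ₙ Kₙ Zₙ Zₙ₊₁ + ∑ₙ Bₙ Zₙ`.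
The choice `K = 0` is the exchange model and `K = J` is the Heisenberg model, both in the
magnetic fields `B`. -/
noncomputable def hamiltonian {M : ℕ} (J K : Fin M → ℝ) (B : Fin (M + 1) → ℝ) : Operator M :=
  ∑ n : Fin M, (J n : ℂ) •
      (onSite n.castSucc pauliX * onSite n.succ pauliX
        + onSite n.castSucc pauliY * onSite n.succ pauliY)
    + ∑ n : Fin M, (K n : ℂ) • (onSite n.castSucc pauliZ * onSite n.succ pauliZ)
    + ∑ n : Fin (M + 1), (B n : ℂ) • onSite n pauliZ

/-- The configuration with site `n` in state `1` and all other sites in state `0`. -/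
def excite {M : ℕ} (n : Fin (M + 1)) : Fin (M + 1) → Fin 2 := Pi.single n 1

/-- The basis state with a single excitation, located on site `n`. -/
def ket {M : ℕ} (n : Fin (M + 1)) : (Fin (M + 1) → Fin 2) → ℂ := Pi.single (excite n) 1

/-- Perfect end-to-end transfer: `exp (-i H t₀) |10…0⟩ = exp (i φ) |0…01⟩` for some
time `t₀ > 0` and some phase `φ`. -/
def PerfectTransfer {M : ℕ} (H : Operator M) : Prop :=
  ∃ t₀ φ : ℝ, 0 < t₀ ∧
    (NormedSpace.exp ((-(Complex.I * (t₀ : ℂ))) • H)).mulVec (ket 0)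
      = Complex.exp (Complex.I * (φ : ℂ)) • ket (Fin.last M)

/-- The matrix of `H` on the single-excitation subspace. -/
def singleExcitationBlock {M : ℕ} (H : Operator M) :
    Matrix (Fin (M + 1)) (Fin (M + 1)) ℂ :=
  H.submatrix excite excite

/-- `v` is a normalised eigenvector of `h` for the largest real eigenvalue of `h`. -/
def IsTopEigenvector {ι : Type*} [Fintype ι] (h : Matrix ι ι ℂ) (v : ι → ℂ) : Prop :=
  ∃ μ : ℝ,
    IsGreatest {ν : ℝ | ∃ w : ι → ℂ, w ≠ 0 ∧ h.mulVec w = (ν : ℂ) • w} μ ∧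
      h.mulVec v = (μ : ℂ) • v ∧ ∑ i, ‖v i‖ ^ 2 = 1

end SpinChain

namespace SpinChain

open Matrix

/-! The single-excitation block is a Jacobi matrix. With eigenvalues `lam k` decreasing and
orthonormal real eigenvectors `w k`, the number w_k(0) w_k(M) ∏_{j≠k} (lam_k - lam_j) is a positive
constant independent of k (`IsJacobi.exists_mul_prod_sub_eq`), so the spectrum is simple and end
components never vanish. Transfer forces |w_k(0)| = |w_k(M)| and lam_0 - lam_k = m_k π / t with m_k
an integer; the signs in the product formula give m_k the parity of k. With D_k = ∏_{j≠k} (m_k -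
m_j), the quantity (-1)^{m_k} w_k(0)² D_k is then constant, and ∑ w_k(0)² = 1 yields w_0(0)² · r = 1
with r = D_0 ∑ (-1)^{m_k} / D_k rational (`IsJacobi.exists_nodes_of_transfer`).

It remains to find powers of 2 in r. For at least two nodes ∑ 1/D_k = 0, so r is 2 D_0 times the sum
of 1/D_k over even nodes. That sum is a divided difference, at the even nodes, of the reciprocal of
a product over odd nodes; its denominator is odd and its parity is a binomial coefficient
(`hasParity_invDividedDiff`). The nonzero even nodes contribute 2^⌊M/2⌋ to D_0. For odd M ≥ 3 the
last factor 2 comes from the evenness of a central binomial coefficient. -/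

/-! ### Divided differences and their parity -/

/-- The divided difference of `x ↦ ∏ y ∈ Y, (x - y)⁻¹` at the nodes `X`. -/
def invDividedDiff (X Y : Finset ℤ) : ℚ :=
  ∑ x ∈ X, ((∏ x' ∈ X.erase x, ((x : ℚ) - x')) * ∏ y ∈ Y, ((x : ℚ) - y))⁻¹

/-- Partial fractions: (x - y)/((z - x)(z - y)) = 1/(z - x) - 1/(z - y). When x is even and y odd,
this recursion divides only by an odd number. -/
theorem sub_mul_invDividedDiff {X Y : Finset ℤ} {x y : ℤ} (hx : x ∉ X) (hy : y ∉ Y)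
    (hXy : y ∉ insert x X) :
    ((x : ℚ) - y) * invDividedDiff (insert x X) (insert y Y)
      = invDividedDiff (insert x X) Y - invDividedDiff X (insert y Y) := by
  simp only [invDividedDiff]
  rw [Finset.sum_insert hx, Finset.sum_insert hx, mul_add, Finset.mul_sum, add_sub_assoc,
    ← Finset.sum_sub_distrib]
  have hxy : (x : ℚ) - y ≠ 0 := by
    rw [sub_ne_zero]; intro h; apply hXy; simp [Int.cast_inj.mp h]
  congr 1
  · rw [Finset.prod_insert hy, mul_inv, mul_inv, mul_inv]
    field_simp
  · refine Finset.sum_congr rfl fun z hz => ?_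
    have hzx : z ≠ x := fun h => hx (h ▸ hz)
    have hzy : z ≠ y := fun h => hXy (by simp [← h, hz])
    have h1 : (z : ℚ) - x ≠ 0 := by rw [sub_ne_zero]; exact_mod_cast hzx
    have h2 : (z : ℚ) - y ≠ 0 := by rw [sub_ne_zero]; exact_mod_cast hzy
    rw [Finset.erase_insert_of_ne hzx.symm, Finset.prod_insert (by simp [hx]),
      Finset.prod_insert hy]
    simp only [mul_inv]
    field_simp
    ring

theorem sub_mul_invDividedDiff_insert_insert {X Y : Finset ℤ} {x x' : ℤ} (hx : x ∉ X)
    (hx' : x' ∉ X) (hxx' : x ≠ x') :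
    ((x : ℚ) - x') * invDividedDiff (insert x (insert x' X)) Y
      = invDividedDiff (insert x X) Y - invDividedDiff (insert x' X) Y := by
  have h0 : (x : ℚ) - x' ≠ 0 := by rw [sub_ne_zero]; exact_mod_cast hxx'
  simp only [invDividedDiff]
  have hx2 : x ∉ insert x' X := by simp [hx, hxx']
  rw [Finset.sum_insert hx2, Finset.sum_insert hx', Finset.sum_insert hx, Finset.sum_insert hx',
    Finset.erase_insert hx2, Finset.erase_insert hx, Finset.erase_insert hx',
    Finset.erase_insert_of_ne hxx', Finset.erase_insert hx', Finset.prod_insert hx',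
    Finset.prod_insert hx, mul_add, mul_add, Finset.mul_sum, add_sub_add_comm,
    ← Finset.sum_sub_distrib, ← add_assoc]
  have h0' : (x' : ℚ) - x = -((x : ℚ) - x') := by ring
  congr 1
  · simp only [h0', mul_inv, inv_neg]
    field_simp
    ring
  · refine Finset.sum_congr rfl fun z hz => ?_
    have hzx : z ≠ x := fun h => hx (h ▸ hz)
    have hzx' : z ≠ x' := fun h => hx' (h ▸ hz)
    have h1 : (z : ℚ) - x ≠ 0 := by rw [sub_ne_zero]; exact_mod_cast hzx
    have h2 : (z : ℚ) - x' ≠ 0 := by rw [sub_ne_zero]; exact_mod_cast hzx'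
    rw [Finset.erase_insert_of_ne hzx.symm, Finset.erase_insert_of_ne hzx'.symm,
      Finset.erase_insert_of_ne hzx.symm, Finset.prod_insert (by simp [hxx', hx]),
      Finset.prod_insert (fun h => hx (Finset.mem_of_mem_erase h)),
      Finset.prod_insert (fun h => hx' (Finset.mem_of_mem_erase h))]
    simp only [mul_inv]
    field_simp
    ring

theorem invDividedDiff_singleton_empty (x : ℤ) : invDividedDiff {x} ∅ = 1 := by
  simp [invDividedDiff]

/-- Divided differences of the constant 1 vanish at two or more nodes. -/
theorem invDividedDiff_empty_right (n : ℕ) :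
    ∀ X : Finset ℤ, X.card = n + 2 → invDividedDiff X ∅ = 0 := by
  induction n with
  | zero =>
    intro X hX
    obtain ⟨x, y, hxy, rfl⟩ := Finset.card_eq_two.mp hX
    have h := sub_mul_invDividedDiff_insert_insert (X := ∅) (Y := ∅) (by simp) (by simp) hxy
    have h0 : (x : ℚ) - y ≠ 0 := by rw [sub_ne_zero]; exact_mod_cast hxy
    simpa [invDividedDiff_singleton_empty, h0] using h
  | succ n ih =>
    intro X hX
    obtain ⟨x, X₁, hx, rfl, hX₁⟩ := Finset.card_eq_succ.mp hX
    obtain ⟨y, X₂, hy, rfl, hX₂⟩ := Finset.card_eq_succ.mp hX₁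
    have hxy : x ≠ y := by rintro rfl; simp at hx
    have hx2 : x ∉ X₂ := fun h => hx (by simp [h])
    have h := sub_mul_invDividedDiff_insert_insert (Y := ∅) hx2 hy hxy
    have h0 : (x : ℚ) - y ≠ 0 := by rw [sub_ne_zero]; exact_mod_cast hxy
    rw [ih _ hX₁, ih (insert x X₂) (by rw [Finset.card_insert_of_notMem hx2, hX₂])] at h
    simpa [h0] using h

/-- `r` is a fraction with odd denominator and its residue modulo `2` is that of `c`. -/
def HasParity (r : ℚ) (c : ℤ) : Prop :=
  ∃ a b : ℤ, Odd b ∧ r * b = a ∧ (2 : ℤ) ∣ a - c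

/-- Modulo 2 the factor x - y is 1 and signs disappear, so the recursion `sub_mul_invDividedDiff`
becomes Pascal's rule. -/
theorem hasParity_invDividedDiff (s : ℕ) : ∀ (p q : ℕ) (X Y : Finset ℤ), p + q = s →
    X.card = p + 1 → Y.card = q → (∀ x ∈ X, Even x) → (∀ y ∈ Y, Odd y) →
    HasParity (invDividedDiff X Y) ((p + q - 1).choose p : ℕ) := by
  induction s with
  | zero =>
    intro p q X Y hs hX hY _ _
    obtain ⟨rfl, rfl⟩ : p = 0 ∧ q = 0 := by omega
    obtain ⟨x, rfl⟩ := Finset.card_eq_one.mp hX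
    rw [Finset.card_eq_zero.mp hY, invDividedDiff_singleton_empty]
    -- Truncated subtraction makes the binomial coefficient `choose 0 0 = 1`.
    exact ⟨1, 1, by decide, by norm_num, by simp⟩
  | succ s ih =>
    intro p q X Y hs hX hY hXe hYo
    obtain ⟨x, X', hx, rfl, hX'⟩ := Finset.card_eq_succ.mp hX
    rcases q with _ | q
    · rw [Finset.card_eq_zero.mp hY]
      obtain ⟨r, rfl⟩ : ∃ r, p = r + 1 := ⟨p - 1, by omega⟩
      rw [invDividedDiff_empty_right r _ hX]
      exact ⟨0, 1, by decide, by norm_num, by simp⟩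
    · obtain ⟨y, Y', hy, rfl, hY'⟩ := Finset.card_eq_succ.mp hY
      have hyo : Odd y := hYo y (by simp)
      have hxe : Even x := hXe x (by simp)
      have hXy : y ∉ insert x X' := fun h => (Int.not_even_iff_odd.mpr hyo) (hXe y h)
      have h := sub_mul_invDividedDiff hx hy hXy
      have hxyo : Odd (x - y) := hxe.sub_odd hyo
      obtain ⟨a₁, b₁, hb₁, h₁, hd₁⟩ := ih p q (insert x X') Y' (by omega) hX hY' hXe
        (fun z hz => hYo z (by simp [hz]))
      rcases p with _ | p
      · rw [Finset.card_eq_zero.mp hX'] at h h₁ ⊢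
        refine ⟨a₁, (x - y) * b₁, hxyo.mul hb₁, ?_, by simpa using hd₁⟩
        have h2 : invDividedDiff ∅ (insert y Y') = 0 := by simp [invDividedDiff]
        rw [h2, sub_zero] at h
        rw [← h₁, ← h]
        push_cast
        ring
      · obtain ⟨a₂, b₂, hb₂, h₂, hd₂⟩ := ih p (q + 1) X' (insert y Y') (by omega) hX' hY
          (fun z hz => hXe z (by simp [hz])) hYo
        refine ⟨a₁ * b₂ - a₂ * b₁, (x - y) * b₁ * b₂, (hxyo.mul hb₁).mul hb₂, ?_, ?_⟩
        · push_cast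
          rw [← h₁, ← h₂]
          linear_combination (b₁ * b₂ : ℚ) * h
        · have hc : (p + 1 + (q + 1) - 1).choose (p + 1)
              = (p + (q + 1) - 1).choose p + (p + 1 + q - 1).choose (p + 1) := by
            have e1 : p + 1 + (q + 1) - 1 = (p + q) + 1 := by omega
            have e2 : p + (q + 1) - 1 = p + q := by omega
            have e3 : p + 1 + q - 1 = p + q := by omega
            rw [e1, e2, e3, Nat.choose_succ_succ]
          rw [hc]
          push_cast
          obtain ⟨u, hu⟩ := hd₁
          obtain ⟨v, hv⟩ := hd₂
          obtain ⟨k, rfl⟩ := hb₁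
          obtain ⟨l, rfl⟩ := hb₂
          exact ⟨u + v + a₁ * l - a₂ * k - a₂, by linear_combination hu + hv⟩

/-! ### Powers of two in the alternating weight sum -/

theorem card_filter_even_fin (M : ℕ) :
    (Finset.univ.filter fun k : Fin (M + 1) => Even (k : ℕ)).card = M / 2 + 1 := by
  rw [Finset.card_filter, Fin.sum_univ_eq_sum_range (fun k => if Even k then 1 else 0)]
  induction M with
  | zero => decide
  | succ M ih =>
    rw [Finset.sum_range_succ, ih]
    split_ifs with h
    · obtain ⟨r, hr⟩ := h; omega
    · obtain ⟨r, hr⟩ := Nat.not_even_iff_odd.mp h; omega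

theorem pow_two_dvd_den {q r : ℚ} {b n : ℤ} {c : ℕ} (hqr : q * r = 1) (hb : Odd b)
    (h : r * b = 2 ^ c * n) : 2 ^ c ∣ q.den := by
  have h1 : q * (2 ^ c * n) = b := by rw [← h, ← mul_assoc, hqr, one_mul]
  have h2 : (q.num : ℚ) * (2 ^ c * n) = b * q.den := by
    rw [← h1, ← Rat.mul_den_eq_num q]; ring
  have h3 : q.num * (2 ^ c * n) = b * q.den := by exact_mod_cast h2
  have h4 : (2 ^ c : ℤ) ∣ b * q.den := ⟨q.num * n, by rw [← h3]; ring⟩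
  have h5 : IsCoprime (2 ^ c : ℤ) b := IsCoprime.pow_left (Int.isCoprime_two_left.mpr hb)
  have h6 := h5.dvd_of_dvd_mul_left h4
  exact_mod_cast h6

/-- The alternating sum of reciprocal node weights, normalised at the node `0`. -/
def alternatingWeightSum (S : Finset ℤ) : ℚ :=
  (∏ x ∈ S.erase 0, (-x : ℚ)) *
    ∑ x ∈ S, (if Even x then 1 else -1) * (∏ y ∈ S.erase x, ((x : ℚ) - y))⁻¹

theorem sum_filter_even_eq_invDividedDiff (S : Finset ℤ) :
    ∑ x ∈ S with Even x, (∏ y ∈ S.erase x, ((x : ℚ) - y))⁻¹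
      = invDividedDiff (S.filter Even) (S.filter fun x => ¬ Even x) := by
  refine Finset.sum_congr rfl fun x hx => ?_
  rw [← Finset.prod_filter_mul_prod_filter_not (S.erase x) Even, Finset.filter_erase,
    Finset.filter_erase, Finset.erase_eq_of_notMem (a := x)
      (s := S.filter fun x => ¬ Even x) (by simp [(Finset.mem_filter.mp hx).2])]

/-- The unsigned sum of reciprocal weights is zero, so its even and odd parts are opposite and the
alternating sum doubles the even part. -/
theorem alternatingWeightSum_eq {S : Finset ℤ} (hS : 2 ≤ S.card) :
    alternatingWeightSum S = 2 * (∏ x ∈ S.erase 0, (-x : ℚ)) *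
      invDividedDiff (S.filter Even) (S.filter fun x => ¬ Even x) := by
  have h0 : ∑ x ∈ S, (∏ y ∈ S.erase x, ((x : ℚ) - y))⁻¹ = 0 := by
    have h := invDividedDiff_empty_right (S.card - 2) S (by omega)
    simpa [invDividedDiff] using h
  rw [← Finset.sum_filter_add_sum_filter_not S Even] at h0
  rw [alternatingWeightSum, ← sum_filter_even_eq_invDividedDiff,
    ← Finset.sum_filter_add_sum_filter_not S Even]
  have h1 : ∑ x ∈ S with Even x,
        (if Even x then 1 else -1) * (∏ y ∈ S.erase x, ((x : ℚ) - y))⁻¹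
      = ∑ x ∈ S with Even x, (∏ y ∈ S.erase x, ((x : ℚ) - y))⁻¹ :=
    Finset.sum_congr rfl fun x hx => by rw [if_pos (Finset.mem_filter.mp hx).2, one_mul]
  have h2 : ∑ x ∈ S with ¬ Even x,
        (if Even x then 1 else -1) * (∏ y ∈ S.erase x, ((x : ℚ) - y))⁻¹
      = - ∑ x ∈ S with ¬ Even x, (∏ y ∈ S.erase x, ((x : ℚ) - y))⁻¹ := by
    rw [← Finset.sum_neg_distrib]
    exact Finset.sum_congr rfl fun x hx => by
      rw [if_neg (Finset.mem_filter.mp hx).2, neg_one_mul]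
  rw [h1, h2, eq_neg_of_add_eq_zero_right h0]
  ring

theorem prod_neg_erase_zero (S : Finset ℤ) (h0 : 0 ∈ S) :
    ∃ A o : ℤ, Odd o ∧
      ∏ x ∈ S.erase 0, (-x : ℚ) = 2 ^ ((S.filter Even).card - 1) * A * o := by
  have h1 : (2 : ℤ) ^ ((S.filter Even).card - 1) ∣ ∏ x ∈ (S.filter Even).erase 0, -x := by
    rw [← Finset.card_erase_of_mem (a := (0 : ℤ)) (by simp [h0]), ← Finset.prod_const]
    refine Finset.prod_dvd_prod_of_dvd _ _ fun x hx => ?_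
    rw [dvd_neg]
    exact (Finset.mem_filter.mp (Finset.mem_of_mem_erase hx)).2.two_dvd
  obtain ⟨A, hA⟩ := h1
  refine ⟨A, ∏ x ∈ S with ¬ Even x, -x, ?_, ?_⟩
  · refine Finset.prod_induction _ Odd (fun a b => Odd.mul) odd_one fun x hx => ?_
    exact (Int.not_even_iff_odd.mp (Finset.mem_filter.mp hx).2).neg
  · have h2 : ∏ x ∈ S.erase 0, (-x)
        = 2 ^ ((S.filter Even).card - 1) * A * ∏ x ∈ S with ¬ Even x, -x := by
      rw [← hA, ← Finset.prod_filter_mul_prod_filter_not (S.erase 0) Even, Finset.filter_erase,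
        Finset.filter_erase,
        Finset.erase_eq_of_notMem (s := S.filter fun x => ¬ Even x) (by simp)]
    exact_mod_cast h2

theorem ceil_half_succ (M : ℕ) : ⌈(((M + 1 : ℕ) : ℚ) + 1) / 2⌉₊ = (M + 1) / 2 + 1 := by
  rw [Nat.ceil_eq_iff (by omega)]
  obtain ⟨k, hk⟩ | ⟨k, hk⟩ := Nat.even_or_odd M
  · have : (M + 1) / 2 = k := by omega
    rw [this, hk]
    push_cast
    constructor <;> linarith
  · have : (M + 1) / 2 = k + 1 := by omega
    rw [this, hk]
    push_cast
    constructor <;> linarith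

/-- One factor 2 comes from the doubling and `M / 2` from the even nodes other than 0. This suffices
for even `M`; odd `M` needs one more. -/
theorem pow_two_dvd_den_of_mul_alternatingWeightSum {M : ℕ} (hM : 2 ≤ M) {S : Finset ℤ}
    (hS : S.card = M + 1) (h0 : 0 ∈ S) (hE : (S.filter Even).card = M / 2 + 1) {q : ℚ}
    (hq : q * alternatingWeightSum S = 1) : 2 ^ ((M + 1) / 2 + 1) ∣ q.den := by
  have hO : (S.filter fun x => ¬ Even x).card = (M + 1) / 2 := by
    have := Finset.card_filter_add_card_filter_not (s := S) Even
    omega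
  obtain ⟨a, b, hb, hab, hd⟩ := hasParity_invDividedDiff _ (M / 2) ((M + 1) / 2) _ _ rfl hE hO
    (fun x hx => (Finset.mem_filter.mp hx).2)
    (fun x hx => Int.not_even_iff_odd.mp (Finset.mem_filter.mp hx).2)
  obtain ⟨A, o, -, hP⟩ := prod_neg_erase_zero S h0
  rw [hE, Nat.add_sub_cancel] at hP
  have hr : alternatingWeightSum S * b = 2 ^ (M / 2 + 1) * (A * o * a) := by
    rw [alternatingWeightSum_eq (by omega), hP, ← hab]
    ring
  obtain ⟨k, hk⟩ | ⟨k, hk⟩ := Nat.even_or_odd M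
  · have e : (M + 1) / 2 = M / 2 := by omega
    rw [e]
    exact pow_two_dvd_den (n := A * o * a) hq hb (by rw [hr]; push_cast; ring)
  · have e1 : M / 2 = k := by omega
    have e2 : (M + 1) / 2 = k + 1 := by omega
    -- For `M = 2k + 1` the coefficient is `choose (2k) k`, even because k ≥ 1; this is where `M =
    -- 1` is excluded.
    have hc : (2 : ℤ) ∣ ((M / 2 + (M + 1) / 2 - 1).choose (M / 2) : ℕ) := by
      rw [e1, e2, show k + (k + 1) - 1 = 2 * k by omega]
      exact_mod_cast Nat.two_dvd_centralBinom_of_one_le (by omega : 0 < k)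
    obtain ⟨a', rfl⟩ : (2 : ℤ) ∣ a := (dvd_sub_left hc).mp hd
    rw [e2]
    rw [e1] at hr
    exact pow_two_dvd_den (n := A * o * a') hq hb (by rw [hr]; push_cast; ring)

theorem alternatingWeightSum_of_card_eq_two {S : Finset ℤ} (hS : S.card = 2) (h0 : 0 ∈ S)
    (hE : (S.filter Even).card = 1) : alternatingWeightSum S = 2 := by
  obtain ⟨y, hy⟩ : ∃ y, S.erase 0 = {y} :=
    Finset.card_eq_one.mp (by rw [Finset.card_erase_of_mem h0, hS])
  have hy0 : y ≠ 0 := Finset.ne_of_mem_erase (s := S) (by rw [hy]; simp)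
  obtain rfl : S = {0, y} := by rw [← Finset.insert_erase h0, hy]
  have hyo : ¬ Even y := by
    intro h
    rw [Finset.filter_true_of_mem (by simp [h])] at hE
    omega
  have e1 : ({0, y} : Finset ℤ).erase y = {0} := by
    ext z; simp only [Finset.mem_erase, Finset.mem_insert, Finset.mem_singleton]; grind
  have hq : (y : ℚ) ≠ 0 := by exact_mod_cast hy0
  rw [alternatingWeightSum, Finset.sum_pair hy0.symm, hy, e1]
  simp [hyo]
  field_simp
  norm_num

theorem rational_of_mul_alternatingWeightSum {M : ℕ} {m : Fin (M + 1) → ℤ} (hm : StrictMono m)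
    (h0 : m 0 = 0) (hpar : ∀ k, Even (m k) ↔ Even (k : ℕ)) {w : ℝ}
    (hw : w * alternatingWeightSum (Finset.univ.image m) = 1) :
    ∃ q : ℚ, w = q ∧ (2 ≤ M → 2 ^ ((M + 1) / 2 + 1) ∣ q.den) ∧ (M = 1 → q = 1 / 2) := by
  have hS : (Finset.univ.image m).card = M + 1 := by
    rw [Finset.card_image_of_injective _ hm.injective, Finset.card_univ, Fintype.card_fin]
  have h0S : (0 : ℤ) ∈ Finset.univ.image m := by
    rw [← h0]; exact Finset.mem_image_of_mem _ (Finset.mem_univ _)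
  have hE : ((Finset.univ.image m).filter Even).card = M / 2 + 1 := by
    rw [Finset.filter_image, Finset.card_image_of_injective _ hm.injective,
      ← card_filter_even_fin M]
    simp only [hpar]
  set r := alternatingWeightSum (Finset.univ.image m)
  have hr : r ≠ 0 := by rintro hr; simp [hr] at hw
  refine ⟨r⁻¹, ?_, fun hM => ?_, fun hM => ?_⟩
  · rw [Rat.cast_inv]
    exact eq_inv_of_mul_eq_one_left hw
  · exact pow_two_dvd_den_of_mul_alternatingWeightSum hM hS h0S hE (inv_mul_cancel₀ hr)
  · subst hM
    rw [show r = 2 from alternatingWeightSum_of_card_eq_two hS h0S (by rw [hE])]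
    norm_num

/-! ### Spectral theory of Jacobi matrices -/

section

theorem exists_antitone_eigenbasis {n : ℕ} {A : Matrix (Fin n) (Fin n) ℝ} (hA : A.IsSymm) :
    ∃ (lam : Fin n → ℝ) (w : Fin n → Fin n → ℝ), Antitone lam ∧
      (∀ k, A *ᵥ w k = lam k • w k) ∧
      (∀ i j, ∑ k, w k i * w k j = if i = j then 1 else 0) ∧
      (∀ k l, ∑ i, w k i * w l i = if k = l then 1 else 0) := by
  have hH : A.IsHermitian := by rwa [IsHermitian, conjTranspose_eq_transpose_of_trivial]
  let σ := Tuple.sort fun k => -hH.eigenvalues k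
  have hU := (mem_unitaryGroup_iff.mp hH.eigenvectorUnitary.2)
  have hU' := (mem_unitaryGroup_iff'.mp hH.eigenvectorUnitary.2)
  refine ⟨fun k => hH.eigenvalues (σ k), fun k => hH.eigenvectorBasis (σ k), ?_, ?_, ?_, ?_⟩
  · intro k l hkl
    have := Tuple.monotone_sort (fun k => -hH.eigenvalues k) hkl
    exact neg_le_neg_iff.mp this
  · exact fun k => hH.mulVec_eigenvectorBasis (σ k)
  · intro i j
    have h := congrFun (congrFun hU i) j
    rw [mul_apply, one_apply] at h
    rw [← h]
    exact Equiv.sum_comp σ fun k => hH.eigenvectorBasis k i * hH.eigenvectorBasis k j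
  · intro k l
    have h := congrFun (congrFun hU' (σ k)) (σ l)
    rw [mul_apply, one_apply] at h
    simp only [σ.injective.eq_iff] at h
    rw [← h]
    rfl

/-- A real symmetric tridiagonal matrix with positive off-diagonal entries. -/
structure IsJacobi {M : ℕ} (A : Matrix (Fin (M + 1)) (Fin (M + 1)) ℝ) : Prop where
  symm : A.IsSymm
  eq_zero : ∀ i j : Fin (M + 1), (j : ℕ) + 1 < i → A i j = 0
  pos : ∀ i j : Fin (M + 1), (j : ℕ) + 1 = i → 0 < A i j

variable {M : ℕ} {A : Matrix (Fin (M + 1)) (Fin (M + 1)) ℝ} {lam : Fin (M + 1) → ℝ}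
  {w : Fin (M + 1) → Fin (M + 1) → ℝ}

/-- The sum is the i-th entry of ∏_{j∈s} (A - lam_j) e_0, expanded in eigenvectors. Each factor
extends the support by one site, and the entry at the frontier is a product of subdiagonal entries,
hence independent of the shifts. -/
theorem IsJacobi.exists_prod_shift_apply (hA : IsJacobi A) (hw : ∀ k, A *ᵥ w k = lam k • w k)
    (hc : ∀ i j, ∑ k, w k i * w k j = if i = j then 1 else 0) (r : ℕ) (hr : r ≤ M) :
    ∃ P : ℝ, 0 < P ∧ ∀ s : Finset (Fin (M + 1)), s.card = r → ∀ i : Fin (M + 1),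
      (r < i → ∑ l, w l 0 * (∏ j ∈ s, (lam l - lam j)) * w l i = 0) ∧
      (r = i → ∑ l, w l 0 * (∏ j ∈ s, (lam l - lam j)) * w l i = P) := by
  induction r with
  | zero =>
    refine ⟨1, one_pos, fun s hs i => ?_⟩
    rw [Finset.card_eq_zero.mp hs]
    simp only [Finset.prod_empty, mul_one, hc]
    constructor
    · intro hi
      rw [if_neg]
      rintro rfl
      simp at hi
    · intro hi
      rw [if_pos]
      exact Fin.ext hi
  | succ r ih =>
    obtain ⟨P, hP, h⟩ := ih (by omega)
    let a : Fin (M + 1) := ⟨r, by omega⟩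
    let b : Fin (M + 1) := ⟨r + 1, by omega⟩
    refine ⟨A b a * P, mul_pos (hA.pos b a rfl) hP, fun s hs i => ?_⟩
    obtain ⟨j, s', hj, rfl, hs'⟩ := Finset.card_eq_succ.mp hs
    have key : ∑ l, w l 0 * (∏ j ∈ insert j s', (lam l - lam j)) * w l i
        = ∑ x, A i x * (∑ l, w l 0 * (∏ j ∈ s', (lam l - lam j)) * w l x)
          - lam j * ∑ l, w l 0 * (∏ j ∈ s', (lam l - lam j)) * w l i := by
      simp_rw [Finset.mul_sum]
      rw [Finset.sum_comm, ← Finset.sum_sub_distrib]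
      refine Finset.sum_congr rfl fun l _ => ?_
      have hl : ∑ x, A i x * w l x = lam l * w l i := congrFun (hw l) i
      have : ∑ x, A i x * (w l 0 * (∏ j ∈ s', (lam l - lam j)) * w l x)
          = w l 0 * (∏ j ∈ s', (lam l - lam j)) * ∑ x, A i x * w l x := by
        rw [Finset.mul_sum]
        exact Finset.sum_congr rfl fun x _ => by ring
      rw [this, hl, Finset.prod_insert hj]
      ring
    constructor
    · intro hi
      rw [key, (h s' hs' i).1 (by omega), mul_zero, sub_zero]
      refine Finset.sum_eq_zero fun x _ => ?_
      by_cases hx : r < x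
      · rw [(h s' hs' x).1 hx, mul_zero]
      · rw [hA.eq_zero i x (by omega), zero_mul]
    · intro hi
      obtain rfl : b = i := Fin.ext hi
      rw [key, (h s' hs' b).1 (by omega), mul_zero, sub_zero, Finset.sum_eq_single a,
        (h s' hs' a).2 rfl]
      · intro x _ hxa
        have hxr : (x : ℕ) ≠ r := fun e => hxa (Fin.ext e)
        by_cases hx : r < x
        · rw [(h s' hs' x).1 hx, mul_zero]
        · rw [hA.eq_zero b x (by change (x : ℕ) + 1 < r + 1; omega), zero_mul]
      · simp

/-- Shifting by every eigenvalue except the k-th annihilates all spectral terms but the k-th. -/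
theorem IsJacobi.exists_mul_prod_sub_eq (hA : IsJacobi A) (hw : ∀ k, A *ᵥ w k = lam k • w k)
    (hc : ∀ i j, ∑ k, w k i * w k j = if i = j then 1 else 0) :
    ∃ P : ℝ, 0 < P ∧ ∀ k,
      w k 0 * w k (Fin.last M) * ∏ j ∈ Finset.univ.erase k, (lam k - lam j) = P := by
  obtain ⟨P, hP, h⟩ := hA.exists_prod_shift_apply hw hc M le_rfl
  refine ⟨P, hP, fun k => ?_⟩
  rw [← (h (Finset.univ.erase k) (by simp) (Fin.last M)).2 rfl, Finset.sum_eq_single k]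
  · ring
  · intro l _ hl
    rw [Finset.prod_eq_zero (i := l) (by simp [hl]) (sub_self _)]
    ring
  · simp

theorem neg_one_pow_mul_prod_sub_pos {m : Fin (M + 1) → ℤ} (hm : StrictMono m)
    (k : Fin (M + 1)) :
    0 < (-1) ^ (M + k : ℕ) * ∏ j ∈ Finset.univ.erase k, (m k - m j) := by
  have h1 : Finset.univ.erase k = Finset.Iio k ∪ Finset.Ioi k := by
    ext j; simp
  have h2 : Disjoint (Finset.Iio k) (Finset.Ioi k) := by
    rw [Finset.disjoint_left]; intro j; simp; exact fun h => h.le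
  have h3 : ∏ j ∈ Finset.Ioi k, (m k - m j)
      = (-1) ^ (M - k : ℕ) * ∏ j ∈ Finset.Ioi k, (m j - m k) := by
    have : (Finset.Ioi k).card = M - k := by rw [Fin.card_Ioi]; omega
    rw [← this, ← Finset.prod_const, ← Finset.prod_mul_distrib]
    exact Finset.prod_congr rfl fun j _ => by ring
  have h4 : (-1 : ℤ) ^ (M + k : ℕ) * (-1) ^ (M - k : ℕ) = 1 := by
    rw [← pow_add]
    exact Even.neg_one_pow ⟨M, by omega⟩
  rw [h1, Finset.prod_union h2, h3, mul_left_comm, ← mul_assoc (_ ^ _), h4, one_mul]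
  refine mul_pos (Finset.prod_pos fun j hj => ?_) (Finset.prod_pos fun j hj => ?_)
  · exact sub_pos.mpr (hm (Finset.mem_Iio.mp hj))
  · exact sub_pos.mpr (hm (Finset.mem_Ioi.mp hj))

/-! ### Spectral consequences of perfect transfer -/

theorem exists_int_mul_pi_of_exp_sq_eq_one {x : ℝ}
    (h : Complex.exp (Complex.I * x) ^ 2 = 1) :
    ∃ n : ℤ, x = n * Real.pi ∧ Complex.exp (Complex.I * x) = if Even n then 1 else -1 := by
  rw [← Complex.exp_nat_mul, Complex.exp_eq_one_iff] at h
  obtain ⟨n, hn⟩ := h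
  have hx : (x : ℂ) = n * Real.pi := by
    apply mul_left_cancel₀ (mul_ne_zero two_ne_zero Complex.I_ne_zero)
    push_cast at hn
    linear_combination hn
  refine ⟨n, by exact_mod_cast hx, ?_⟩
  rw [hx, show Complex.I * (n * Real.pi) = n * (Real.pi * Complex.I) by ring,
    Complex.exp_int_mul, Complex.exp_pi_mul_I]
  split_ifs with he
  · exact he.neg_one_zpow
  · exact (Int.not_even_iff_odd.mp he).neg_one_zpow

/-- Dividing the two relations cancels the unknown phase φ and leaves a unimodular number equal to a
real ratio, hence ±1. -/
theorem exists_sign_of_transfer {t φ a b x y c d : ℝ} (hx : x ≠ 0) (hc : c ≠ 0)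
    (h1 : Complex.exp (-(Complex.I * t) * a) * x = Complex.exp (Complex.I * φ) * y)
    (h2 : Complex.exp (-(Complex.I * t) * b) * c = Complex.exp (Complex.I * φ) * d) :
    ∃ n : ℤ, t * (a - b) = n * Real.pi ∧ d * x = (if Even n then 1 else -1) * (y * c) := by
  have hn : ∀ s : ℝ, ‖Complex.exp (Complex.I * s)‖ = 1 := fun s => by
    rw [mul_comm]; exact Complex.norm_exp_ofReal_mul_I s
  have hn' : ∀ s : ℝ, ‖Complex.exp (-(Complex.I * t) * s)‖ = 1 := fun s => by
    rw [show -(Complex.I * t) * s = Complex.I * ((-(t * s) : ℝ) : ℂ) by push_cast; ring]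
    exact hn _
  have habs : |x| = |y| := by
    simpa only [norm_mul, hn, hn', one_mul, Complex.norm_real, Real.norm_eq_abs]
      using congrArg norm h1
  have habs' : |c| = |d| := by
    simpa only [norm_mul, hn, hn', one_mul, Complex.norm_real, Real.norm_eq_abs]
      using congrArg norm h2
  have hy : y ≠ 0 := by rintro rfl; simp at habs; exact hx habs
  have hz : Complex.exp (-(Complex.I * t) * b)
      = Complex.exp (-(Complex.I * t) * a) * Complex.exp (Complex.I * (t * (a - b) : ℝ)) := by
    rw [← Complex.exp_add]; congr 1; push_cast; ring
  have hE : Complex.exp (Complex.I * (t * (a - b) : ℝ)) * (y * c) = d * x := by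
    apply mul_left_cancel₀ (Complex.exp_ne_zero (Complex.I * φ))
    rw [hz] at h2
    linear_combination (x : ℂ) * h2
      - Complex.exp (Complex.I * (t * (a - b) : ℝ)) * c * h1
  have hyc : (y : ℂ) * c ≠ 0 := by exact_mod_cast mul_ne_zero hy hc
  have hsq : Complex.exp (Complex.I * (t * (a - b) : ℝ)) ^ 2 = 1 := by
    have e1 : x ^ 2 = y ^ 2 := sq_eq_sq_iff_abs_eq_abs x y |>.mpr habs
    have e2 : c ^ 2 = d ^ 2 := sq_eq_sq_iff_abs_eq_abs c d |>.mpr habs'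
    have e3 : ((d : ℂ) * x) ^ 2 = (y * c) ^ 2 := by
      have : (d * x) ^ 2 = (y * c) ^ 2 := by rw [mul_pow, mul_pow, e1, e2]; ring
      exact_mod_cast this
    rw [← hE, mul_pow] at e3
    exact mul_right_cancel₀ (pow_ne_zero 2 hyc) (by rw [e3, one_mul])
  obtain ⟨n, hn1, hn2⟩ := exists_int_mul_pi_of_exp_sq_eq_one hsq
  refine ⟨n, hn1, ?_⟩
  rw [hn2] at hE
  split_ifs at hE ⊢ <;> exact_mod_cast hE.symm

end

theorem cast_alternatingWeightSum_image {M : ℕ} {m : Fin (M + 1) → ℤ} (hm : StrictMono m)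
    (h0 : m 0 = 0) :
    (alternatingWeightSum (Finset.univ.image m) : ℝ)
      = (∏ j ∈ Finset.univ.erase 0, ((m 0 : ℝ) - m j)) *
        ∑ k, (if Even (m k) then 1 else -1) *
          (∏ j ∈ Finset.univ.erase k, ((m k : ℝ) - m j))⁻¹ := by
  have hi := hm.injective
  have herase : ∀ k, (Finset.univ.image m).erase (m k) = (Finset.univ.erase k).image m :=
    fun k => (Finset.image_erase hi _ _).symm
  rw [alternatingWeightSum, Finset.sum_image hi.injOn]
  simp only [herase]
  have hz := herase 0
  rw [h0] at hz
  rw [hz, Finset.prod_image hi.injOn]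
  simp only [Finset.prod_image hi.injOn, h0]
  push_cast
  simp only [zero_sub, apply_ite (Rat.cast : ℚ → ℝ), Rat.cast_one, Rat.cast_neg]

theorem IsJacobi.exists_nodes_of_transfer {M : ℕ} {A : Matrix (Fin (M + 1)) (Fin (M + 1)) ℝ}
    {lam : Fin (M + 1) → ℝ} {w : Fin (M + 1) → Fin (M + 1) → ℝ} (hA : IsJacobi A)
    (hlam : Antitone lam) (hw : ∀ k, A *ᵥ w k = lam k • w k)
    (hc : ∀ i j, ∑ k, w k i * w k j = if i = j then 1 else 0) {t φ : ℝ} (ht : 0 < t)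
    (hT : ∀ k, Complex.exp (-(Complex.I * t) * lam k) * w k 0
      = Complex.exp (Complex.I * φ) * w k (Fin.last M)) :
    StrictAnti lam ∧ ∃ m : Fin (M + 1) → ℤ, StrictMono m ∧ m 0 = 0 ∧
      (∀ k, Even (m k) ↔ Even (k : ℕ)) ∧
      w 0 0 ^ 2 * alternatingWeightSum (Finset.univ.image m) = 1 := by
  obtain ⟨P, hP, hprod⟩ := hA.exists_mul_prod_sub_eq hw hc
  have hne : ∀ k, w k 0 ≠ 0 := fun k h => by
    have := hprod k; rw [h] at this; simp at this; exact hP.ne this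
  have hne' : ∀ k, w k (Fin.last M) ≠ 0 := fun k h => by
    have := hprod k; rw [h] at this; simp at this; exact hP.ne this
  have hinj : Function.Injective lam := by
    intro k l hkl
    by_contra hne
    have h := hprod k
    rw [Finset.prod_eq_zero (i := l) (by simp [Ne.symm hne]) (by rw [hkl, sub_self]),
      mul_zero] at h
    exact hP.ne h
  have hanti : StrictAnti lam := hlam.strictAnti_of_injective hinj
  refine ⟨hanti, ?_⟩
  choose m hm1 hm2 using fun k => exists_sign_of_transfer (hne 0) (hne k) (hT 0) (hT k)
  have hdiff : ∀ k l, lam k - lam l = -(Real.pi / t) * (m k - m l) := by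
    intro k l
    have hk := hm1 k
    have hl := hm1 l
    field_simp
    linear_combination hl - hk
  have hmono : StrictMono m := by
    intro k l hkl
    have h1 := hanti hkl
    have h2 := hdiff k l
    have h3 : 0 < Real.pi / t := div_pos Real.pi_pos ht
    by_contra h
    have h4 : (m l : ℝ) ≤ m k := by exact_mod_cast not_lt.mp h
    nlinarith
  have hm0 : m 0 = 0 := by
    have h := hm1 0
    rw [sub_self, mul_zero] at h
    have := (mul_eq_zero.mp h.symm).resolve_right Real.pi_ne_zero
    exact_mod_cast this
  let D : Fin (M + 1) → ℝ := fun k => ∏ j ∈ Finset.univ.erase k, ((m k : ℝ) - m j)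
  let s : Fin (M + 1) → ℝ := fun k => if Even (m k) then 1 else -1
  have hs : ∀ k, s k * s k = 1 := fun k => by simp only [s]; split_ifs <;> norm_num
  have hprodD : ∀ k, ∏ j ∈ Finset.univ.erase k, (lam k - lam j)
      = (-(Real.pi / t)) ^ M * D k := by
    intro k
    simp only [hdiff k]
    rw [Finset.prod_mul_distrib, Finset.prod_const, Finset.card_erase_of_mem (Finset.mem_univ _),
      Finset.card_univ, Fintype.card_fin, Nat.add_sub_cancel]
  have hD : ∀ k, D k ≠ 0 := by
    intro k h
    have h1 := hprod k
    rw [hprodD, h] at h1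
    simp at h1
    exact hP.ne h1
  have hs0 : s 0 = 1 := by simp [s, hm0]
  -- In the product formula, `hm2` trades the last component of `w k` for its first, up to the sign
  -- `s k` and a factor common to all k.
  have hconst : ∀ k, s k * w k 0 ^ 2 * D k = w 0 0 ^ 2 * D 0 := by
    intro k
    have hκ : (-(Real.pi / t)) ^ M ≠ 0 :=
      pow_ne_zero _ (neg_ne_zero.mpr (div_pos Real.pi_pos ht).ne')
    have h1 := (hprod k).trans (hprod 0).symm
    rw [hprodD, hprodD] at h1
    have h2 : w k (Fin.last M) * w 0 0 = s k * (w 0 (Fin.last M) * w k 0) := hm2 k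
    apply mul_left_cancel₀ hκ
    apply mul_left_cancel₀ (hne' 0)
    linear_combination w 0 0 * h1 - w k 0 * (-(Real.pi / t)) ^ M * D k * h2
  refine ⟨m, hmono, hm0, ?_, ?_⟩
  · have hsign : ∀ k : Fin (M + 1), 0 < (-1) ^ (M + k : ℕ) * D k := by
      intro k
      have := neg_one_pow_mul_prod_sub_pos hmono k
      have h : (0 : ℝ) < (((-1) ^ (M + k : ℕ) *
        ∏ j ∈ Finset.univ.erase k, (m k - m j) : ℤ) : ℝ) := by exact_mod_cast this
      push_cast at h
      exact h
    intro k
    have h1 := mul_pos (hsign k) (hsign 0)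
    have h2 : 0 < w k 0 ^ 2 := by have := hne k; positivity
    have h3 : 0 < w 0 0 ^ 2 := by have := hne 0; positivity
    have h4 : 0 < D 0 ^ 2 := by have := hD 0; positivity
    have h5 : ((-1 : ℝ) ^ (M + k : ℕ) * D k) * ((-1) ^ (M + (0 : Fin (M + 1)) : ℕ) * D 0)
        = (-1) ^ (k : ℕ) * (D k * D 0) := by
      have : (-1 : ℝ) ^ M * (-1) ^ M = 1 := by rw [← mul_pow]; norm_num
      rw [Fin.val_zero, add_zero, pow_add]
      linear_combination ((-1 : ℝ) ^ (k : ℕ) * (D k * D 0)) * this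
    rw [h5] at h1
    have h6 : s k * (w k 0 ^ 2 * (D k * D 0)) = w 0 0 ^ 2 * D 0 ^ 2 := by
      linear_combination D 0 * hconst k
    -- By `h6`, `s k` has the sign of D_k D_0; by `h1`, so does (-1)^k.
    have h7 : 0 < s k * (-1) ^ (k : ℕ) := by
      have h8 : 0 < (s k * (w k 0 ^ 2 * (D k * D 0))) * ((-1) ^ (k : ℕ) * (D k * D 0)) :=
        mul_pos (h6 ▸ mul_pos h3 h4) h1
      have h9 : (s k * (w k 0 ^ 2 * (D k * D 0))) * ((-1) ^ (k : ℕ) * (D k * D 0))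
          = (s k * (-1) ^ (k : ℕ)) * (w k 0 ^ 2 * (D k * D 0) ^ 2) := by ring
      rw [h9] at h8
      exact pos_of_mul_pos_left h8 (by positivity)
    by_cases he : Even (m k) <;> by_cases hk : Even (k : ℕ)
    · simp [he, hk]
    · simp [s, he, (Nat.not_even_iff_odd.mp hk).neg_one_pow] at h7
      linarith
    · simp [s, he, hk.neg_one_pow] at h7
      linarith
    · simp [he, hk]
  · rw [cast_alternatingWeightSum_image hmono hm0]
    change w 0 0 ^ 2 * (D 0 * ∑ k, s k * (D k)⁻¹) = 1
    have h1 : ∑ k, w k 0 * w k 0 = 1 := by simpa using hc 0 0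
    rw [← h1, Finset.mul_sum, Finset.mul_sum]
    refine Finset.sum_congr rfl fun k _ => ?_
    have hk := hD k
    rw [← mul_assoc, ← hconst k]
    field_simp
    linear_combination w k 0 ^ 2 * hs k

/-- As μ exceeds every other eigenvalue, `v` is orthogonal to all `w k` with k ≠ 0, so it is a
unimodular multiple of `w 0`. -/
theorem norm_sq_eq_of_mulVec_eq {n : ℕ} {A : Matrix (Fin (n + 1)) (Fin (n + 1)) ℝ}
    (hA : A.IsSymm) {lam : Fin (n + 1) → ℝ} {w : Fin (n + 1) → Fin (n + 1) → ℝ}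
    (hlam : StrictAnti lam) (hw : ∀ k, A *ᵥ w k = lam k • w k)
    (hc : ∀ i j, ∑ k, w k i * w k j = if i = j then 1 else 0)
    (hr : ∀ k l, ∑ i, w k i * w l i = if k = l then 1 else 0) {μ : ℝ} (hμ : lam 0 ≤ μ)
    {v : Fin (n + 1) → ℂ} (hv : A.map (fun x => (x : ℂ)) *ᵥ v = (μ : ℂ) • v)
    (hn : ∑ i, ‖v i‖ ^ 2 = 1) : ‖v 0‖ ^ 2 = w 0 0 ^ 2 := by
  let c : Fin (n + 1) → ℂ := fun k => ∑ i, (w k i : ℂ) * v i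
  have hexp : ∀ i, v i = ∑ k, c k * w k i := by
    intro i
    have h : ∀ j, ∑ k, (w k i : ℂ) * w k j = if i = j then 1 else 0 := fun j => by
      have := congrArg (fun x : ℝ => (x : ℂ)) (hc i j)
      push_cast at this
      simpa [apply_ite (fun x : ℝ => (x : ℂ))] using this
    calc v i = ∑ j, (if i = j then 1 else 0) * v j := by simp
      _ = ∑ j, (∑ k, (w k i : ℂ) * w k j) * v j := by simp only [h]
      _ = ∑ k, c k * w k i := by
        simp only [c, Finset.sum_mul]
        rw [Finset.sum_comm]
        exact Finset.sum_congr rfl fun k _ => Finset.sum_congr rfl fun j _ => by ring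
  have hzero : ∀ k, (lam k : ℂ) * c k = μ * c k := by
    intro k
    have h1 : ∀ i, ∑ j, (A i j : ℂ) * v j = μ * v i := fun i => congrFun hv i
    have h2 : ∀ j, ∑ i, (w k i : ℂ) * A i j = lam k * w k j := fun j => by
      have h := congrFun (hw k) j
      have h' : ∑ i, A j i * w k i = lam k * w k j := h
      have := congrArg (fun x : ℝ => (x : ℂ)) h'
      push_cast at this
      rw [← this]
      exact Finset.sum_congr rfl fun i _ => by rw [hA.apply i j, mul_comm]
    calc (lam k : ℂ) * c k = ∑ j, (lam k * w k j) * v j := by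
          simp only [c, Finset.mul_sum, mul_assoc]
      _ = ∑ i, w k i * ∑ j, (A i j : ℂ) * v j := by
          simp only [← h2, Finset.sum_mul, Finset.mul_sum]
          rw [Finset.sum_comm]
          exact Finset.sum_congr rfl fun k _ => Finset.sum_congr rfl fun j _ => by ring
      _ = μ * c k := by
          simp only [h1, c, Finset.mul_sum]
          exact Finset.sum_congr rfl fun k _ => by ring
  have hck : ∀ k, k ≠ 0 → c k = 0 := by
    intro k hk
    have h1 : lam k < μ := (hlam (Fin.pos_iff_ne_zero.mpr hk)).trans_le hμ
    by_contra h
    have := mul_right_cancel₀ h (hzero k)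
    exact h1.ne (by exact_mod_cast this)
  have hv0 : ∀ i, v i = c 0 * w 0 i := by
    intro i
    rw [hexp i, Finset.sum_eq_single 0]
    · intro k _ hk
      rw [hck k hk, zero_mul]
    · simp
  have hnorm : ∀ i, ‖v i‖ ^ 2 = ‖c 0‖ ^ 2 * (w 0 i * w 0 i) := fun i => by
    rw [hv0 i, norm_mul, mul_pow, Complex.norm_real, Real.norm_eq_abs, sq_abs]; ring
  have hr0 : ∑ i, w 0 i * w 0 i = 1 := by simpa using hr 0 0
  simp only [hnorm, ← Finset.mul_sum] at hn
  rw [hr0, mul_one] at hn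
  rw [hnorm, hn]
  ring

/-! ### From the qubit chain to its single-excitation block -/

section

section Exponential

theorem exp_mulVec_of_mulVec_eq {ι : Type*} [Fintype ι] [DecidableEq ι] {X : Matrix ι ι ℂ}
    {v : ι → ℂ} {c : ℂ} (h : X *ᵥ v = c • v) :
    NormedSpace.exp X *ᵥ v = Complex.exp c • v := by
  have hpow : ∀ n : ℕ, (X ^ n) *ᵥ v = c ^ n • v := by
    intro n
    induction n with
    | zero => simp
    | succ n ih => rw [pow_succ, ← mulVec_mulVec, h, mulVec_smul, ih, smul_smul, pow_succ']
  have hX : HasSum (fun n : ℕ => ((n.factorial : ℂ)⁻¹) • X ^ n) (NormedSpace.exp X) := by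
    let _ : NormedRing (Matrix ι ι ℂ) := Matrix.linftyOpNormedRing
    let _ : NormedAlgebra ℂ (Matrix ι ι ℂ) := Matrix.linftyOpNormedAlgebra
    exact NormedSpace.exp_series_hasSum_exp' X
  have h1 := hX.map (mulVec.addMonoidHomLeft v)
    (by exact continuous_id.matrix_mulVec continuous_const)
  have h2 : HasSum (fun n : ℕ => ((n.factorial : ℂ)⁻¹ • c ^ n) • v) (Complex.exp c • v) := by
    rw [Complex.exp_eq_exp_ℂ]
    exact (NormedSpace.exp_series_hasSum_exp' c).smul_const v
  refine h1.unique (h2.congr_fun ?_)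
  intro n
  simp [mulVec.addMonoidHomLeft, smul_mulVec, hpow, smul_smul]

/-- Pair the transfer equation with `W` under the bilinear dot product; the exponential of a
symmetric matrix is symmetric and can be moved onto `W`. -/
theorem exp_mul_apply_eq_of_isSymm {ι : Type*} [Fintype ι] [DecidableEq ι] {H : Matrix ι ι ℂ}
    (hH : H.IsSymm) {W : ι → ℂ} {lam z e : ℂ} (hW : H *ᵥ W = lam • W) {a b : ι}
    (h : NormedSpace.exp (z • H) *ᵥ Pi.single a 1 = e • Pi.single b 1) :
    Complex.exp (z * lam) * W a = e * W b := by
  have h1 : NormedSpace.exp (z • H) *ᵥ W = Complex.exp (z * lam) • W :=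
    exp_mulVec_of_mulVec_eq (by rw [smul_mulVec, hW, smul_smul])
  have h2 : (NormedSpace.exp (z • H)).IsSymm := (hH.smul z).exp
  have h3 : W ⬝ᵥ (NormedSpace.exp (z • H) *ᵥ Pi.single a 1)
      = (NormedSpace.exp (z • H) *ᵥ W) ⬝ᵥ Pi.single a 1 := by
    rw [dotProduct_mulVec, ← mulVec_transpose, h2.eq]
  rw [h, h1] at h3
  simpa using h3.symm

end Exponential

theorem onSite_mul_onSite_apply {M : ℕ} {a b : Fin (M + 1)} (hab : a ≠ b)
    (P Q : Matrix (Fin 2) (Fin 2) ℂ) (s t : Fin (M + 1) → Fin 2) :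
    (onSite a P * onSite b Q) s t
      = if ∀ m, m ≠ a → m ≠ b → s m = t m then P (s a) (t a) * Q (s b) (t b) else 0 := by
  rw [mul_apply, Finset.sum_eq_single (Function.update s a (t a))]
  · simp only [onSite]
    rw [if_pos (fun m hm => by rw [Function.update_of_ne hm]), Function.update_self,
      Function.update_of_ne hab.symm]
    by_cases h : ∀ m, m ≠ a → m ≠ b → s m = t m
    · rw [if_pos h, if_pos]
      intro m hm
      by_cases hma : m = a
      · subst hma; rw [Function.update_self]
      · rw [Function.update_of_ne hma]; exact h m hma hm
    · rw [if_neg h, if_neg, mul_zero]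
      intro h'
      apply h
      intro m hma hmb
      have := h' m hmb
      rwa [Function.update_of_ne hma] at this
  · intro u _ hu
    simp only [onSite]
    by_cases h1 : ∀ m, m ≠ a → s m = u m
    · rw [if_neg (c := ∀ m, m ≠ b → u m = t m), mul_zero]
      intro h2
      apply hu
      funext m
      by_cases hma : m = a
      · subst hma; rw [Function.update_self]; exact h2 m hab
      · rw [Function.update_of_ne hma]; exact (h1 m hma).symm
    · rw [if_neg h1, zero_mul]
  · simp

theorem eq_comp_swap_iff {M : ℕ} {a b : Fin (M + 1)} (s t : Fin (M + 1) → Fin 2) :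
    s = t ∘ Equiv.swap a b ↔
      (∀ m, m ≠ a → m ≠ b → s m = t m) ∧ s a = t b ∧ s b = t a := by
  constructor
  · rintro rfl
    refine ⟨fun m hma hmb => ?_, ?_, ?_⟩ <;> simp only [Function.comp_apply]
    · rw [Equiv.swap_apply_of_ne_of_ne hma hmb]
    · rw [Equiv.swap_apply_left]
    · rw [Equiv.swap_apply_right]
  · rintro ⟨h1, h2, h3⟩
    funext m
    rw [Function.comp_apply]
    by_cases hma : m = a
    · subst hma; rw [Equiv.swap_apply_left, h2]
    by_cases hmb : m = b
    · subst hmb; rw [Equiv.swap_apply_right, h3]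
    rw [Equiv.swap_apply_of_ne_of_ne hma hmb, h1 m hma hmb]

/-- XX and YY add up on antiparallel spins and cancel on parallel ones, so the exchange term is
twice a swap of unequal neighbours. -/
theorem exchange_apply {M : ℕ} {a b : Fin (M + 1)} (hab : a ≠ b) (s t : Fin (M + 1) → Fin 2) :
    (onSite a pauliX * onSite b pauliX + onSite a pauliY * onSite b pauliY) s t
      = if s = t ∘ Equiv.swap a b ∧ s a ≠ s b then 2 else 0 := by
  rw [Matrix.add_apply, onSite_mul_onSite_apply hab, onSite_mul_onSite_apply hab]
  simp only [eq_comp_swap_iff]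
  by_cases h : ∀ m, m ≠ a → m ≠ b → s m = t m
  · simp only [eq_true h, if_true, true_and]
    generalize s a = p
    generalize s b = q
    generalize t a = x
    generalize t b = y
    fin_cases p <;> fin_cases q <;> fin_cases x <;> fin_cases y <;>
      simp [pauliX, pauliY] <;> norm_num
  · simp [h]

/-- The eigenvalues of the Pauli matrix `Z`. -/
def zSign (p : Fin 2) : ℝ := if p = 0 then 1 else -1

theorem pauliZ_apply (p q : Fin 2) : pauliZ p q = if p = q then (zSign p : ℂ) else 0 := by
  fin_cases p <;> fin_cases q <;> simp [pauliZ, zSign]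

theorem onSite_pauliZ_apply {M : ℕ} (a : Fin (M + 1)) (s t : Fin (M + 1) → Fin 2) :
    onSite a pauliZ s t = if s = t then (zSign (s a) : ℂ) else 0 := by
  rw [onSite, pauliZ_apply, ← ite_and]
  congr 1
  rw [eq_iff_iff, funext_iff]
  exact ⟨fun h m => if hm : m = a then hm ▸ h.2 else h.1 m hm, fun h => ⟨fun m _ => h m, h a⟩⟩

theorem onSite_pauliZ_mul_apply {M : ℕ} (a b : Fin (M + 1)) (s t : Fin (M + 1) → Fin 2) :
    (onSite a pauliZ * onSite b pauliZ) s t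
      = if s = t then ((zSign (s a) * zSign (s b) : ℝ) : ℂ) else 0 := by
  rw [mul_apply]
  simp only [onSite_pauliZ_apply]
  by_cases h : s = t <;> simp [h]

/-- The energy of a configuration under the `Z`-part of the Hamiltonian. -/
def zEnergy {M : ℕ} (K : Fin M → ℝ) (B : Fin (M + 1) → ℝ) (s : Fin (M + 1) → Fin 2) : ℝ :=
  ∑ n : Fin M, K n * (zSign (s n.castSucc) * zSign (s n.succ))
    + ∑ n : Fin (M + 1), B n * zSign (s n)

/-- The entries of the chain Hamiltonian, as real numbers. -/
def hamiltonianEntry {M : ℕ} (J K : Fin M → ℝ) (B : Fin (M + 1) → ℝ)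
    (s t : Fin (M + 1) → Fin 2) : ℝ :=
  ∑ n : Fin M, J n *
      (if s = t ∘ Equiv.swap n.castSucc n.succ ∧ s n.castSucc ≠ s n.succ then 2 else 0)
    + if s = t then zEnergy K B s else 0

variable {M : ℕ} (J K : Fin M → ℝ) (B : Fin (M + 1) → ℝ)

theorem hamiltonian_apply (s t : Fin (M + 1) → Fin 2) :
    hamiltonian J K B s t = (hamiltonianEntry J K B s t : ℂ) := by
  rw [hamiltonian, hamiltonianEntry, zEnergy, Matrix.add_apply, Matrix.add_apply,
    Matrix.sum_apply, Matrix.sum_apply, Matrix.sum_apply, add_assoc, Complex.ofReal_add]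
  simp only [Matrix.smul_apply, exchange_apply (Fin.castSucc_lt_succ).ne,
    onSite_pauliZ_mul_apply, onSite_pauliZ_apply, smul_eq_mul]
  congr 1
  · rw [Complex.ofReal_sum]
    refine Finset.sum_congr rfl fun n _ => ?_
    split_ifs <;> simp
  · by_cases h : s = t
    · simp [h]
    · simp [h]

theorem hamiltonianEntry_symm (s t : Fin (M + 1) → Fin 2) :
    hamiltonianEntry J K B s t = hamiltonianEntry J K B t s := by
  simp only [hamiltonianEntry]
  congr 1
  · refine Finset.sum_congr rfl fun n _ => ?_
    congr 1
    refine if_congr ?_ rfl rfl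
    rw [eq_comp_swap_iff, eq_comp_swap_iff]
    constructor
    · rintro ⟨⟨h1, h2, h3⟩, h4⟩
      exact ⟨⟨fun m ha hb => (h1 m ha hb).symm, h3.symm, h2.symm⟩, by rw [← h2, ← h3]; exact h4.symm⟩
    · rintro ⟨⟨h1, h2, h3⟩, h4⟩
      exact ⟨⟨fun m ha hb => (h1 m ha hb).symm, h3.symm, h2.symm⟩, by rw [← h2, ← h3]; exact h4.symm⟩
  · by_cases h : s = t
    · simp [h]
    · rw [if_neg h, if_neg (Ne.symm h)]

theorem isSymm_hamiltonian : (hamiltonian J K B).IsSymm := by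
  ext s t
  rw [transpose_apply, hamiltonian_apply, hamiltonian_apply, hamiltonianEntry_symm]

theorem excite_injective : Function.Injective (excite (M := M)) := by
  intro i j h
  by_contra hij
  have := congrFun h i
  simp [excite, hij] at this

theorem excite_comp_swap (a b k : Fin (M + 1)) :
    excite k ∘ Equiv.swap a b = excite (Equiv.swap a b k) := by
  funext m
  simp only [excite, Function.comp_apply, Pi.single_apply]
  exact if_congr (by rw [Equiv.swap_apply_eq_iff]) rfl rfl

/-- Swaps conserve the number of excitations. -/
theorem exists_eq_excite_of_hamiltonianEntry_ne_zero {s : Fin (M + 1) → Fin 2}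
    {k : Fin (M + 1)} (h : hamiltonianEntry J K B s (excite k) ≠ 0) : ∃ i, s = excite i := by
  by_contra! hs
  apply h
  rw [hamiltonianEntry, if_neg (hs k), add_zero]
  refine Finset.sum_eq_zero fun n _ => ?_
  rw [if_neg, mul_zero]
  rintro ⟨h1, -⟩
  exact hs _ (h1.trans (excite_comp_swap _ _ _))

/-- The single-excitation block of the chain Hamiltonian, as a real matrix. -/
def jacobiBlock : Matrix (Fin (M + 1)) (Fin (M + 1)) ℝ :=
  fun i j => hamiltonianEntry J K B (excite i) (excite j)

theorem singleExcitationBlock_hamiltonian :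
    singleExcitationBlock (hamiltonian J K B)
      = (jacobiBlock J K B).map (fun x => (x : ℂ)) := by
  ext i j
  exact hamiltonian_apply J K B _ _

theorem isJacobi_jacobiBlock (hJ : ∀ n, 0 < J n) : IsJacobi (jacobiBlock J K B) where
  symm := by
    ext i j
    exact hamiltonianEntry_symm J K B _ _
  eq_zero i j hij := by
    have hne : excite i ≠ excite j := fun h => by
      have := excite_injective h
      rw [this] at hij
      omega
    rw [jacobiBlock, hamiltonianEntry, if_neg hne, add_zero]
    refine Finset.sum_eq_zero fun n _ => ?_
    rw [if_neg, mul_zero]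
    rintro ⟨h1, -⟩
    rw [excite_comp_swap] at h1
    have h2 := excite_injective h1
    rw [Equiv.swap_apply_def] at h2
    split_ifs at h2 with h3 h4
    · rw [h2, h3, Fin.val_succ, Fin.val_castSucc] at hij; omega
    · rw [h2, h4, Fin.val_succ, Fin.val_castSucc] at hij; omega
    · rw [h2] at hij; omega
  pos i j hij := by
    have hne : excite i ≠ excite j := fun h => by
      have := excite_injective h
      rw [this] at hij
      omega
    rw [jacobiBlock, hamiltonianEntry, if_neg hne, add_zero]
    refine Finset.sum_pos' (fun n _ => mul_nonneg (hJ n).le (by split_ifs <;> norm_num))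
      ⟨⟨j, by omega⟩, Finset.mem_univ _, ?_⟩
    rw [if_pos]
    · exact mul_pos (hJ _) two_pos
    · have ej : Fin.castSucc (⟨j, by omega⟩ : Fin M) = j := rfl
      have ei : Fin.succ (⟨j, by omega⟩ : Fin M) = i := Fin.ext hij
      rw [ej, ei, excite_comp_swap, Equiv.swap_apply_left]
      have hji : j ≠ i := fun h => hne (by rw [h])
      exact ⟨rfl, by simp [excite, hji]⟩

/-- Extension by zero works because the single-excitation subspace is invariant; thus the full
exponential can be tested on eigenvectors of the block. -/
theorem exists_eigenvector_extension {lam : ℝ} {w : Fin (M + 1) → ℝ}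
    (hw : jacobiBlock J K B *ᵥ w = lam • w) :
    ∃ W : (Fin (M + 1) → Fin 2) → ℂ, hamiltonian J K B *ᵥ W = (lam : ℂ) • W ∧
      ∀ i, W (excite i) = w i := by
  let W : (Fin (M + 1) → Fin 2) → ℂ := fun s => ∑ n, if s = excite n then (w n : ℂ) else 0
  have hWe : ∀ i, W (excite i) = w i := fun i => by
    simp [W, excite_injective.eq_iff]
  refine ⟨W, ?_, hWe⟩
  funext s
  have h1 : (hamiltonian J K B *ᵥ W) s
      = ((∑ n, hamiltonianEntry J K B s (excite n) * w n : ℝ) : ℂ) := by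
    simp only [mulVec, dotProduct, W, Finset.mul_sum, hamiltonian_apply, mul_ite, mul_zero]
    rw [Finset.sum_comm]
    push_cast
    exact Finset.sum_congr rfl fun n _ => by simp
  rw [h1, Pi.smul_apply, smul_eq_mul]
  by_cases hs : ∃ i, s = excite i
  · obtain ⟨i, rfl⟩ := hs
    have h2 : ∑ n, hamiltonianEntry J K B (excite i) (excite n) * w n = lam * w i :=
      congrFun hw i
    rw [hWe, h2, Complex.ofReal_mul]
  · have h2 : W s = 0 := Finset.sum_eq_zero fun n _ => if_neg fun h => hs ⟨n, h⟩
    rw [h2, mul_zero, Finset.sum_eq_zero, Complex.ofReal_zero]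
    intro n _
    by_contra h
    exact hs (exists_eq_excite_of_hamiltonianEntry_ne_zero J K B (left_ne_zero_of_mul h))

end

end SpinChain

theorem lemma4 (M N : ℕ) (hN : N = M + 1)
    (J K : Fin M → ℝ) (B : Fin (M + 1) → ℝ) (hJ : ∀ n, 0 < J n)
    (hPT : SpinChain.PerfectTransfer (SpinChain.hamiltonian J K B))
    (v : Fin (M + 1) → ℂ)
    (hv : SpinChain.IsTopEigenvector
      (SpinChain.singleExcitationBlock (SpinChain.hamiltonian J K B)) v) :
    ∃ q : ℚ, ‖v 0‖ ^ 2 = (q : ℝ) ∧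
      (3 ≤ N → 2 ^ ⌈((N : ℚ) + 1) / 2⌉₊ ∣ q.den) ∧ (N = 2 → q = 1 / 2) := by
  subst hN
  have hA := SpinChain.isJacobi_jacobiBlock J K B hJ
  obtain ⟨lam, w, hlam, hw, hc, hr⟩ := SpinChain.exists_antitone_eigenbasis hA.symm
  obtain ⟨t, φ, ht, hT⟩ := hPT
  obtain ⟨hanti, m, hm, hm0, hpar, hsum⟩ := hA.exists_nodes_of_transfer hlam hw hc ht
    (φ := φ) fun k => by
      obtain ⟨W, hW, hWe⟩ := SpinChain.exists_eigenvector_extension J K B (hw k)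
      have h := SpinChain.exp_mul_apply_eq_of_isSymm (SpinChain.isSymm_hamiltonian J K B) hW hT
      rwa [hWe, hWe] at h
  obtain ⟨μ, hμ, hvμ, hvn⟩ := hv
  rw [SpinChain.singleExcitationBlock_hamiltonian] at hμ hvμ
  -- Only this half of μ = lam_0 is needed: `w 0`, read as a complex vector, witnesses lam_0 as an
  -- eigenvalue.
  have hle : lam 0 ≤ μ := by
    refine hμ.2 ⟨fun i => (w 0 i : ℂ), ?_, ?_⟩
    · intro h
      have h1 : ∀ i, w 0 i = 0 := fun i => Complex.ofReal_eq_zero.mp (congrFun h i)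
      have h2 := hr 0 0
      simp [h1] at h2
    · funext i
      have h1 : ∑ j, SpinChain.jacobiBlock J K B i j * w 0 j = lam 0 * w 0 i :=
        congrFun (hw 0) i
      have h2 := congrArg (fun x : ℝ => (x : ℂ)) h1
      push_cast at h2
      exact h2
  rw [SpinChain.norm_sq_eq_of_mulVec_eq hA.symm hanti hw hc hr hle hvμ hvn]
  obtain ⟨q, hq, hq3, hq2⟩ := SpinChain.rational_of_mul_alternatingWeightSum hm hm0 hpar hsum
  refine ⟨q, hq, fun h3 => ?_, fun h2 => hq2 (by omega)⟩
  rw [SpinChain.ceil_half_succ]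
  exact hq3 (by omega)
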